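/- Let $M$ be a closed manifold, i.e. a compact connected boundaryless smooth manifold endowed with a (smooth) Riemannian metric $\|\cdot\|$, and let $d$ be the induced distance. Let $V$ be a $C^1$ vector field on $M$, let $V_t$ ($t\in\mathbb{R}$) be its flow, write $V_I(x)=\{V_t(x):t\in I\}$ for $I\subset\mathbb{R}$, and put $\mathrm{Sing}(V)=\{x\in M: V(x)=0\}$. For $z\in M$ and $A\subset M$ let $\mathrm{dist}(z,A)=\inf_{a\in A}d(z,a)$ if $A\neq\emptyset$, and $\mathrm{dist}(z,\emptyset)=\mathrm{diam}(M)$. Let $\Lambda\subset M$. (a) $V$ is singular-expansive on $\Lambda$ if for every $\epsilon>0$ there is $\delta>0$ such that, whenever $x,y\in\Lambda$ and an increasing homeomorphism $s:\mathbb{R}\to\mathbb{R}$ satisfy $d(V_t(x),V_{s(t)}(y))\le\delta\,\mathrm{dist}(V_t(x),\mathrm{Sing}(V))$ for every $t\in\mathbb{R}$, one has $V_{s(t_0)}(y)\in V_{[t_0-\epsilon,\,t_0+\epsilon]}(x)$ for some $t_0\in\mathbb{R}$. (b) $V$ is rescaling expansive on $\Lambda$ if for every $\epsilon>0$ there is $\delta>0$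 such that, whenever $x,y\in\Lambda$ and an increasing homeomorphism $s:\mathbb{R}\to\mathbb{R}$ satisfy $d(V_t(x),V_{s(t)}(y))\le\delta\,\|V(V_t(x))\|$ for every $t\in\mathbb{R}$, one has $V_{s(0)}(y)\in V_{[-\epsilon,\,\epsilon]}(x)$. Proposition. Suppose that $\Lambda\subset M$ is compact and invariant, i.e. $V_t(\Lambda)=\Lambda$ for every $t\in\mathbb{R}$. If $V$ is singular-expansive on $\Lambda$, then $V$ is rescaling expansive on $\Lambda$. -/

import Mathlib

open scoped Manifold ContDiff Bundle

namespace RiemFlow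

section

variable {E : Type*} [NormedAddCommGroup E] [NormedSpace ℝ E]
  {M : Type*} [MetricSpace M] [ChartedSpace E M]

/-- `flow V t x` is the value at time `t` of the global integral curve of `V` starting at `x`.
On a closed manifold every `C^1` vector field has exactly one such curve through each point;
where there is none, `flow V t x` is `x`. -/
noncomputable def flow (V : (x : M) → TangentSpace 𝓘(ℝ, E) x) (t : ℝ) (x : M) : M :=
  open Classical in
  if h : ∃ γ : ℝ → M, γ 0 = x ∧ IsMIntegralCurve (I := 𝓘(ℝ, E)) γ V then h.choose t else x

theorem flow_spec (V : (x : M) → TangentSpace 𝓘(ℝ, E) x) (x : M)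
    (h : ∃ γ : ℝ → M, γ 0 = x ∧ IsMIntegralCurve (I := 𝓘(ℝ, E)) γ V) :
    flow V 0 x = x ∧ IsMIntegralCurve (I := 𝓘(ℝ, E)) (fun t => flow V t x) V := by
  have e : (fun t => flow V t x) = h.choose := by
    funext t
    simp only [flow, dif_pos h]
  refine ⟨?_, ?_⟩
  · exact (congrFun e 0).trans h.choose_spec.1
  · rw [e]
    exact h.choose_spec.2

/-- `V_I(x)`, the piece of the orbit of `x` over the set of times `I`. -/
def orbitPiece (V : (x : M) → TangentSpace 𝓘(ℝ, E) x) (I : Set ℝ) (x : M) : Set M :=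
  (fun t => flow V t x) '' I

/-- `Λ` is invariant: `V_t(Λ) = Λ` for every real `t`. -/
def IsFlowInvariant (V : (x : M) → TangentSpace 𝓘(ℝ, E) x) (Λ : Set M) : Prop :=
  ∀ t : ℝ, flow V t '' Λ = Λ

/-- The set of zeros of the vector field. -/
def singSet (V : (x : M) → TangentSpace 𝓘(ℝ, E) x) : Set M :=
  {x | V x = 0}

/-- The distance from a point to a set, with the convention that the distance to the empty set
is the diameter of the whole space. -/
noncomputable def distToSet (z : M) (A : Set M) : ℝ :=
  open Classical in
  if A = ∅ then Metric.diam (Set.univ : Set M) else ⨅ a : A, dist z (a : M)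

/-- Singular-expansivity of `V` on `Λ`. -/
def SingularExpansiveOn (V : (x : M) → TangentSpace 𝓘(ℝ, E) x) (Λ : Set M) : Prop :=
  ∀ ε : ℝ, 0 < ε → ∃ δ : ℝ, 0 < δ ∧
    ∀ x ∈ Λ, ∀ y ∈ Λ, ∀ s : ℝ ≃ₜ ℝ, StrictMono s →
      (∀ t : ℝ, dist (flow V t x) (flow V (s t) y) ≤ δ * distToSet (flow V t x) (singSet V)) →
      ∃ t₀ : ℝ, flow V (s t₀) y ∈ orbitPiece V (Set.Icc (t₀ - ε) (t₀ + ε)) x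

/-- Rescaling expansivity of `V` on `Λ`; the norm is that of the Riemannian metric. -/
def RescalingExpansiveOn [Bundle.RiemannianBundle (fun x : M => TangentSpace 𝓘(ℝ, E) x)]
    (V : (x : M) → TangentSpace 𝓘(ℝ, E) x) (Λ : Set M) : Prop :=
  ∀ ε : ℝ, 0 < ε → ∃ δ : ℝ, 0 < δ ∧
    ∀ x ∈ Λ, ∀ y ∈ Λ, ∀ s : ℝ ≃ₜ ℝ, StrictMono s →
      (∀ t : ℝ, dist (flow V t x) (flow V (s t) y) ≤ δ * ‖V (flow V t x)‖) →
      flow V (s 0) y ∈ orbitPiece V (Set.Icc (-ε) ε) x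

end

end RiemFlow

/-! ### Local-to-global principle and a Lipschitz ODE estimate -/

open Set Filter Metric Manifold
open scoped Topology NNReal ENNReal

/-! Since `V` is `C^1` on a compact manifold, `‖V‖` is at most a constant times the distance to the
zeros (`exists_norm_le_mul_distToSet`). Closeness at the rescaled scale is therefore closeness at
the singular scale, and singular-expansivity puts `y` on the orbit of `x`: `V_{s(t)}(y) =
V_{t+h(t)}(x)` with `h` continuous and small at one time.

It remains to carry smallness of `h` to time `0`. For times `|u| ≤ C⁻¹`, a trajectory moves at least
`|u|‖V‖ / C` from its start (`exists_abs_mul_norm_le_dist`). Against the rescaled closeness this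
says that `|h(t)| < C⁻¹` forces `|h(t)| ≤ ε' < C⁻¹`. The times with `|h| ≤ ε'` are then clopen,
hence all of `ℝ`.

Both estimates are proved locally in charts, where `V` is Lipschitz, and made uniform by
compactness. -/

/-- A property depending monotonically on a positive constant which holds locally on a compact
space holds globally. -/
theorem exists_forall_of_eventually_nhds {X : Type*} [TopologicalSpace X] [CompactSpace X]
    {P : ℝ → X → Prop} (mono : ∀ C C' x, 0 < C → C ≤ C' → P C x → P C' x)
    (h : ∀ p, ∃ C > 0, ∀ᶠ x in 𝓝 p, P C x) : ∃ C > 0, ∀ x, P C x := by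
  have : ∃ C > 0, ∀ x ∈ (univ : Set X), P C x := by
    refine isCompact_univ.induction_on (p := fun s => ∃ C > 0, ∀ x ∈ s, P C x)
      ⟨1, one_pos, by simp⟩ ?_ ?_ ?_
    · rintro s t hst ⟨C, hC, H⟩
      exact ⟨C, hC, fun x hx => H x (hst hx)⟩
    · rintro s t ⟨C, hC, H⟩ ⟨C', hC', H'⟩
      refine ⟨max C C', lt_max_of_lt_left hC, ?_⟩
      rintro x (hx | hx)
      · exact mono _ _ _ hC (le_max_left _ _) (H x hx)
      · exact mono _ _ _ hC' (le_max_right _ _) (H' x hx)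
    · intro p _
      obtain ⟨C, hC, H⟩ := h p
      exact ⟨_, mem_nhdsWithin_of_mem_nhds H, C, hC, fun x hx => hx⟩
  simpa using this

/-- Short time displacement along a solution of a Lipschitz autonomous ODE is comparable to the
initial speed times the elapsed time. -/
theorem abs_mul_norm_le_norm_sub_of_lipschitz {F : Type*} [NormedAddCommGroup F] [NormedSpace ℝ F]
    {W : F → F} {f : ℝ → F} {L : ℝ≥0} {T : ℝ} {s : Set F} (hW : LipschitzOnWith L W s)
    (hf : ∀ t ∈ Icc (-T) T, HasDerivAt f (W (f t)) t) (hs : ∀ t ∈ Icc (-T) T, f t ∈ s)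
    (hLT : L * T ≤ 1 / 4) {u : ℝ} (hu : u ∈ Icc (-T) T) :
    |u| * ‖W (f 0)‖ ≤ 2 * ‖f u - f 0‖ := by
  have hT : 0 ≤ T := by linarith [hu.1, hu.2]
  have h0 : (0 : ℝ) ∈ Icc (-T) T := ⟨by linarith, hT⟩
  have hcont : ContinuousOn (fun t => ‖W (f t)‖) (Icc (-T) T) :=
    (hW.continuousOn.comp (fun t ht => (hf t ht).continuousAt.continuousWithinAt) hs).norm
  obtain ⟨τ, hτ, hmax⟩ := isCompact_Icc.exists_isMaxOn ⟨0, h0⟩ hcont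
  set m := ‖W (f τ)‖ with hm
  have hbound : ∀ t ∈ Icc (-T) T, ‖f t - f 0‖ ≤ m * T := by
    intro t ht
    have := (convex_Icc (-T) T).norm_image_sub_le_of_norm_hasDerivWithin_le
      (fun t ht => (hf t ht).hasDerivWithinAt) (fun t ht => hmax ht) h0 ht
    refine this.trans ?_
    rw [sub_zero]
    exact mul_le_mul_of_nonneg_left (abs_le.2 ht) (norm_nonneg _)
  -- With `m` the maximal speed, `L * T ≤ 1/4` lets the velocity vary by at most `m / 4`, so `m` is
  -- at most `4/3` of the initial speed.
  have hdiff : ∀ t ∈ Icc (-T) T, ‖W (f t) - W (f 0)‖ ≤ m / 4 := by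
    intro t ht
    calc ‖W (f t) - W (f 0)‖ ≤ L * ‖f t - f 0‖ := hW.norm_sub_le (hs t ht) (hs 0 h0)
      _ ≤ L * (m * T) := by gcongr; exact hbound t ht
      _ = (L * T) * m := by ring
      _ ≤ 1 / 4 * m := by gcongr
      _ = m / 4 := by ring
  have hm' : m ≤ 4 / 3 * ‖W (f 0)‖ := by
    have := (norm_le_norm_sub_add (W (f τ)) (W (f 0))).trans
      (add_le_add_left (hdiff τ hτ) _)
    linarith
  -- Mean value inequality for the deviation of `f` from uniform motion with the initial velocity.
  have hg : ‖(f u - u • W (f 0)) - (f 0 - (0 : ℝ) • W (f 0))‖ ≤ (m / 4) * ‖u - 0‖ :=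
    (convex_Icc (-T) T).norm_image_sub_le_of_norm_hasDerivWithin_le
      (f := fun t => f t - t • W (f 0)) (f' := fun t => W (f t) - W (f 0))
      (fun t ht => by
        have := (hf t ht).sub ((hasDerivAt_id t).smul_const (W (f 0)))
        rw [one_smul] at this
        exact this.hasDerivWithinAt)
      hdiff h0 hu
  have e : (f u - u • W (f 0)) - (f 0 - (0 : ℝ) • W (f 0)) = (f u - f 0) - u • W (f 0) := by
    rw [zero_smul]; abel
  rw [e, sub_zero, Real.norm_eq_abs] at hg
  have h3 : |u| * ‖W (f 0)‖ ≤ ‖f u - f 0‖ + m / 4 * |u| := by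
    have := norm_sub_norm_le (u • W (f 0)) (f u - f 0)
    rw [norm_smul, Real.norm_eq_abs, norm_sub_rev (u • W (f 0))] at this
    linarith
  have h4 : m / 4 * |u| ≤ 1 / 3 * (|u| * ‖W (f 0)‖) := by
    have := mul_le_mul_of_nonneg_right hm' (abs_nonneg u)
    linarith
  have h5 : 0 ≤ |u| * ‖W (f 0)‖ := by positivity
  linarith

namespace RiemFlow

/-! ### Vector fields in charts and integral curves -/

section ChartField

variable {E : Type*} [NormedAddCommGroup E] [NormedSpace ℝ E]
  {M : Type*} [TopologicalSpace M] [ChartedSpace E M] [IsManifold 𝓘(ℝ, E) 1 M]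

/-- The vector field `V` read in the preferred chart at `p`. -/
noncomputable def chartField (V : (x : M) → TangentSpace 𝓘(ℝ, E) x) (p : M) (e : E) : E :=
  tangentCoordChange 𝓘(ℝ, E) ((extChartAt 𝓘(ℝ, E) p).symm e) p
    ((extChartAt 𝓘(ℝ, E) p).symm e) (V ((extChartAt 𝓘(ℝ, E) p).symm e))

theorem chartField_extChartAt (V : (x : M) → TangentSpace 𝓘(ℝ, E) x) {p x : M}
    (hx : x ∈ (extChartAt 𝓘(ℝ, E) p).source) :
    chartField V p (extChartAt 𝓘(ℝ, E) p x) = tangentCoordChange 𝓘(ℝ, E) x p x (V x) := by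
  rw [chartField, (extChartAt 𝓘(ℝ, E) p).left_inv hx]

theorem contDiffAt_chartField {V : (x : M) → TangentSpace 𝓘(ℝ, E) x} {p : M}
    (hV : ContMDiffAt 𝓘(ℝ, E) (𝓘(ℝ, E)).tangent 1
      (fun x : M => (⟨x, V x⟩ : TangentBundle 𝓘(ℝ, E) M)) p) :
    ContDiffAt ℝ 1 (chartField V p) (extChartAt 𝓘(ℝ, E) p p) := by
  rw [contMDiffAt_iff] at hV
  exact (hV.2.contDiffAt (by simp)).snd

theorem hasDerivAt_extChartAt_comp {V : (x : M) → TangentSpace 𝓘(ℝ, E) x} {p : M} {γ : ℝ → M}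
    {t : ℝ} (hγ : HasMFDerivAt 𝓘(ℝ, ℝ) 𝓘(ℝ, E) γ t ((1 : ℝ →L[ℝ] ℝ).smulRight (V (γ t))))
    (hsrc : γ t ∈ (extChartAt 𝓘(ℝ, E) p).source) :
    HasDerivAt (extChartAt 𝓘(ℝ, E) p ∘ γ)
      (chartField V p (extChartAt 𝓘(ℝ, E) p (γ t))) t := by
  rw [chartField_extChartAt V hsrc]
  rw [extChartAt_source] at hsrc
  have h := HasMFDerivAt.comp t (hasMFDerivAt_extChartAt (I := 𝓘(ℝ, E)) hsrc) hγ
  rw [mfderiv_chartAt_eq_tangentCoordChange hsrc] at h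
  let v : E := V (γ t)
  have h' : HasFDerivAt (extChartAt 𝓘(ℝ, E) p ∘ γ)
      ((tangentCoordChange 𝓘(ℝ, E) (γ t) p (γ t)).comp ((1 : ℝ →L[ℝ] ℝ).smulRight v)) t :=
    hasMFDerivAt_iff_hasFDerivAt.1 h
  exact h'.hasDerivAt.congr_deriv
    (congrArg (tangentCoordChange 𝓘(ℝ, E) (γ t) p (γ t)) (one_smul ℝ v))

/-- Pulling back a solution of the ODE in a chart gives an integral curve. -/
theorem hasMFDerivAt_extChartAt_symm_comp {V : (x : M) → TangentSpace 𝓘(ℝ, E) x} {p : M}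
    {f : ℝ → E} {t : ℝ} (ht : f t ∈ (extChartAt 𝓘(ℝ, E) p).target)
    (h : HasDerivAt f (chartField V p (f t)) t) :
    HasMFDerivAt 𝓘(ℝ, ℝ) 𝓘(ℝ, E) ((extChartAt 𝓘(ℝ, E) p).symm ∘ f) t
      ((1 : ℝ →L[ℝ] ℝ).smulRight (V ((extChartAt 𝓘(ℝ, E) p).symm (f t)))) := by
  set xₜ : M := (extChartAt 𝓘(ℝ, E) p).symm (f t)
  have hft1 : xₜ ∈ (extChartAt 𝓘(ℝ, E) p).source := (extChartAt 𝓘(ℝ, E) p).map_target ht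
  have hft2 := mem_extChartAt_source (I := 𝓘(ℝ, E)) xₜ
  have hchange : HasFDerivAt (extChartAt 𝓘(ℝ, E) xₜ ∘ (extChartAt 𝓘(ℝ, E) p).symm)
      (tangentCoordChange 𝓘(ℝ, E) p xₜ xₜ) (f t) := by
    apply HasFDerivWithinAt.hasFDerivAt (s := range 𝓘(ℝ, E)) _ (by simp)
    rw [← (extChartAt 𝓘(ℝ, E) p).right_inv ht]
    exact hasFDerivWithinAt_tangentCoordChange ⟨hft1, hft2⟩
  let v : E := V xₜ
  -- In the chart at `xₜ` itself the two coordinate changes cancel, leaving `V xₜ`.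
  have key : HasDerivAt ((extChartAt 𝓘(ℝ, E) xₜ ∘ (extChartAt 𝓘(ℝ, E) p).symm) ∘ f) v t := by
    refine (hchange.comp_hasDerivAt t h).congr_deriv ?_
    exact (tangentCoordChange_comp (I := 𝓘(ℝ, E)) (x := p) ⟨⟨hft2, hft1⟩, hft2⟩).trans
      (tangentCoordChange_self (I := 𝓘(ℝ, E)) hft2)
  refine ⟨(continuousAt_extChartAt_symm'' ht).comp h.continuousAt, ?_⟩
  have key' := key.hasFDerivAt.hasFDerivWithinAt (s := univ)
  rw [← ContinuousLinearMap.smulRight_one_eq_toSpanSingleton] at key'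
  simp only [mfld_simps]
  exact key'

/-- In a chart the velocity is a continuous field along a continuous curve. This regularity is
needed to bound distances by path lengths. -/
theorem contMDiff_of_isMIntegralCurve {V : (x : M) → TangentSpace 𝓘(ℝ, E) x}
    (hV : ContMDiff 𝓘(ℝ, E) (𝓘(ℝ, E)).tangent 1
      (fun x : M => (⟨x, V x⟩ : TangentBundle 𝓘(ℝ, E) M)))
    {γ : ℝ → M} (hγ : IsMIntegralCurve (I := 𝓘(ℝ, E)) γ V) :
    ContMDiff 𝓘(ℝ, ℝ) 𝓘(ℝ, E) 1 γ := by
  intro t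
  rw [contMDiffAt_iff_target]
  refine ⟨hγ.continuous.continuousAt, ?_⟩
  rw [contMDiffAt_iff_contDiffAt]
  set φ := extChartAt 𝓘(ℝ, E) (γ t) with hφ
  have hsrc : ∀ᶠ u in 𝓝 t, γ u ∈ φ.source :=
    hγ.continuous.continuousAt.preimage_mem_nhds (extChartAt_source_mem_nhds (γ t))
  have hcont : ∀ᶠ e in 𝓝 (φ (γ t)), ContinuousAt (chartField V (γ t)) e :=
    ((contDiffAt_chartField (hV (γ t))).eventually (by simp)).mono fun e he => he.continuousAt
  have hφγ : ContinuousAt (φ ∘ γ) t :=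
    (continuousAt_extChartAt (γ t)).comp hγ.continuous.continuousAt
  rw [contDiffAt_one_iff]
  refine ⟨fun u => (1 : ℝ →L[ℝ] ℝ).smulRight (chartField V (γ t) (φ (γ u))), _,
    hsrc.and (hφγ.eventually hcont), ?_, ?_⟩
  · rintro u ⟨hu, hu'⟩
    have h1 : ContinuousAt (fun u => chartField V (γ t) (φ (γ u))) u :=
      ContinuousAt.comp (f := φ ∘ γ) hu' (hasDerivAt_extChartAt_comp (hγ u) hu).continuousAt
    have : ContinuousAt (fun u => (ContinuousLinearMap.smulRightL ℝ ℝ E (1 : ℝ →L[ℝ] ℝ))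
        (chartField V (γ t) (φ (γ u)))) u :=
      (ContinuousLinearMap.continuous _).continuousAt.comp h1
    exact this.continuousWithinAt
  · rintro u ⟨hu, -⟩
    have := (hasDerivAt_extChartAt_comp (hγ u) hu).hasFDerivAt
    rwa [← ContinuousLinearMap.smulRight_one_eq_toSpanSingleton] at this

/-- Local existence of integral curves, on a time interval uniform near a given point. -/
theorem eventually_exists_isMIntegralCurveOn [CompleteSpace E]
    {V : (x : M) → TangentSpace 𝓘(ℝ, E) x} {p : M}
    (hV : ContMDiffAt 𝓘(ℝ, E) (𝓘(ℝ, E)).tangent 1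
      (fun x : M => (⟨x, V x⟩ : TangentBundle 𝓘(ℝ, E) M)) p) :
    ∃ ε > 0, ∀ᶠ x in 𝓝 p, ∃ γ : ℝ → M, γ 0 = x ∧
      IsMIntegralCurveOn (I := 𝓘(ℝ, E)) γ V (Ioo (-ε) ε) := by
  obtain ⟨ε, hε, a, r, L, K, hr, hpl⟩ :=
    IsPicardLindelof.of_contDiffAt_one (contDiffAt_chartField hV)
  obtain ⟨α, hα, hαc⟩ :=
    (hpl 0).exists_forall_mem_closedBall_eq_hasDerivWithinAt_continuousOn
  set φ := extChartAt 𝓘(ℝ, E) p with hφ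
  have hnhds : closedBall (φ p) r ×ˢ Icc (0 - ε) (0 + ε) ∈ 𝓝 (φ p, (0 : ℝ)) :=
    prod_mem_nhds (closedBall_mem_nhds _ hr) (Icc_mem_nhds (by linarith) (by linarith))
  -- Joint continuity in starting point and time keeps nearby solutions in the chart target for a
  -- uniform time.
  have hc : ContinuousAt α (φ p, 0) := hαc.continuousAt hnhds
  have hα0 : α (φ p, 0) = φ p := (hα (φ p) (mem_closedBall_self r.2)).1
  have htgt : φ.target ∈ 𝓝 (α (φ p, 0)) := by
    rw [hα0]; exact extChartAt_target_mem_nhds p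
  obtain ⟨U, hU, J, hJ, hUJ⟩ := mem_nhds_prod_iff.1 (hc.preimage_mem_nhds htgt)
  obtain ⟨η, hη, hηJ⟩ := Metric.mem_nhds_iff.1 hJ
  refine ⟨min ε η, lt_min hε hη, ?_⟩
  filter_upwards [extChartAt_source_mem_nhds (I := 𝓘(ℝ, E)) p,
    (continuousAt_extChartAt (I := 𝓘(ℝ, E)) p).preimage_mem_nhds
      (inter_mem hU (closedBall_mem_nhds _ hr))] with x hx hx'
  refine ⟨φ.symm ∘ fun t => α (φ x, t), ?_, ?_⟩
  · simp only [Function.comp_apply]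
    rw [(hα (φ x) hx'.2).1, φ.left_inv hx]
  · intro t ht
    have ht1 : t ∈ Ioo (0 - ε) (0 + ε) := by
      have := min_le_left ε η
      exact ⟨by linarith [ht.1], by linarith [ht.2]⟩
    have ht2 : t ∈ J := by
      apply hηJ
      rw [mem_ball_zero_iff, Real.norm_eq_abs, abs_lt]
      have := min_le_right ε η
      exact ⟨by linarith [ht.1], by linarith [ht.2]⟩
    have hd := ((hα (φ x) hx'.2).2 t (Ioo_subset_Icc_self ht1)).hasDerivAt
      (Icc_mem_nhds ht1.1 ht1.2)
    have htg : α (φ x, t) ∈ φ.target := hUJ (mk_mem_prod hx'.1 ht2)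
    exact (hasMFDerivAt_extChartAt_symm_comp (V := V) (f := fun t => α (φ x, t)) htg
      hd).hasMFDerivWithinAt

/-- Compactness makes the local existence time uniform, so solutions can be continued forever. The
time is written `C⁻¹` so that the property is monotone in `C`. -/
theorem exists_isMIntegralCurve_of_compactSpace [CompleteSpace E] [CompactSpace M] [T2Space M]
    {V : (x : M) → TangentSpace 𝓘(ℝ, E) x}
    (hV : ContMDiff 𝓘(ℝ, E) (𝓘(ℝ, E)).tangent 1
      (fun x : M => (⟨x, V x⟩ : TangentBundle 𝓘(ℝ, E) M))) (x : M) :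
    ∃ γ : ℝ → M, γ 0 = x ∧ IsMIntegralCurve (I := 𝓘(ℝ, E)) γ V := by
  obtain ⟨C, hC, H⟩ := exists_forall_of_eventually_nhds
    (P := fun C (x : M) => ∃ γ : ℝ → M, γ 0 = x ∧
      IsMIntegralCurveOn (I := 𝓘(ℝ, E)) γ V (Ioo (-C⁻¹) C⁻¹)) (by
        rintro C C' x hC hCC' ⟨γ, h0, hγ⟩
        have := inv_anti₀ hC hCC'
        exact ⟨γ, h0, hγ.mono (Ioo_subset_Ioo (by linarith) this)⟩) (by
        intro p
        obtain ⟨ε, hε, h⟩ := eventually_exists_isMIntegralCurveOn (hV p)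
        exact ⟨ε⁻¹, inv_pos.2 hε, by simpa using h⟩)
  exact exists_isMIntegralCurve_of_isMIntegralCurveOn hV (inv_pos.2 hC) H x

end ChartField

/-! ### Riemannian estimates for the field and its trajectories -/

section Riemannian

variable {E : Type*} [NormedAddCommGroup E] [NormedSpace ℝ E]
  {M : Type*} [MetricSpace M] [ChartedSpace E M] [IsManifold 𝓘(ℝ, E) 1 M]
  [Bundle.RiemannianBundle (fun x : M => TangentSpace 𝓘(ℝ, E) x)]

section Chart

variable [IsContinuousRiemannianBundle E (fun x : M => TangentSpace 𝓘(ℝ, E) x)]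

attribute [local instance] normedAddCommGroupTangentSpaceVectorSpace
  normedSpaceTangentSpaceVectorSpace in
/-- The charts of a Riemannian manifold are locally Lipschitz for the Riemannian distance. -/
theorem exists_ball_dist_extChartAt_le [IsRiemannianManifold 𝓘(ℝ, E) M] (p : M) :
    ∃ C > (0 : ℝ), ∃ r > 0, ∀ x ∈ ball p r, ∀ y ∈ ball p r,
      ‖extChartAt 𝓘(ℝ, E) p x - extChartAt 𝓘(ℝ, E) p y‖ ≤ C * dist x y := by
  obtain ⟨C, C_pos, hC⟩ := eventually_enorm_mfderiv_extChartAt_lt 𝓘(ℝ, E) p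
  obtain ⟨R, hR, hball⟩ := Metric.mem_nhds_iff.1
    (Filter.inter_mem hC (chart_source_mem_nhds E p))
  refine ⟨C, C_pos, R / 4, by positivity, fun x hx y hy => ?_⟩
  have hxy : dist y x < R / 2 := by
    have := dist_triangle_right y x p
    rw [mem_ball] at hx hy
    linarith
  suffices H : ∀ l : ℝ, dist y x < l → l < R / 2 →
      ‖extChartAt 𝓘(ℝ, E) p x - extChartAt 𝓘(ℝ, E) p y‖ ≤ C * l by
    rw [dist_comm]
    have hlim : Tendsto (fun l : ℝ => C * l) (𝓝[>] (dist y x)) (𝓝 (C * dist y x)) :=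
      (tendsto_id.const_mul _).mono_left nhdsWithin_le_nhds
    refine ge_of_tendsto hlim ?_
    filter_upwards [Ioo_mem_nhdsGT hxy] with l hl using H l hl.1 hl.2
  intro l hl hlR
  have hl0 : 0 < l := dist_nonneg.trans_lt hl
  have hed : riemannianEDist 𝓘(ℝ, E) y x < ENNReal.ofReal l := by
    rw [← IsRiemannianManifold.out (I := 𝓘(ℝ, E)) y x, edist_dist]
    exact (ENNReal.ofReal_lt_ofReal_iff hl0).2 hl
  obtain ⟨γ, hγ0, hγ1, γ_smooth, hγ, -⟩ :=
    exists_lt_locally_constant_of_riemannianEDist_lt hed zero_lt_one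
  -- A curve of length less than `R / 2` starting within `R / 4` of `p` cannot leave the ball where
  -- the chart derivative is bounded.
  have hstay : ∀ t ∈ Icc (0 : ℝ) 1, γ t ∈ ball p R := by
    intro t ht
    have h1 : edist y (γ t) < ENNReal.ofReal l := by
      rw [IsRiemannianManifold.out (I := 𝓘(ℝ, E)) y (γ t)]
      refine (riemannianEDist_le_pathELength γ_smooth.contMDiffOn hγ0 rfl ht.1).trans_lt ?_
      exact (pathELength_mono le_rfl ht.2).trans_lt hγ
    rw [edist_dist, ENNReal.ofReal_lt_ofReal_iff hl0] at h1
    have := dist_triangle_left (γ t) p y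
    rw [mem_ball] at hy ⊢
    linarith
  set γ' := extChartAt 𝓘(ℝ, E) p ∘ γ with hγ'
  have hsm : ContMDiffOn 𝓘(ℝ, ℝ) 𝓘(ℝ, E) 1 γ' (Icc 0 1) :=
    contMDiffOn_extChartAt.comp (I' := 𝓘(ℝ, E)) (t := (chartAt E p).source)
      γ_smooth.contMDiffOn (fun t' ht' ↦ (hball (hstay t' ht')).2)
  have key : ‖γ' 1 - γ' 0‖ₑ ≤ ENNReal.ofReal (C * l) := by
    calc
      ‖γ' 1 - γ' 0‖ₑ
    _ ≤ ∫⁻ t' in Icc 0 1, ‖derivWithin γ' (Icc 0 1) t'‖ₑ := by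
      apply enorm_sub_le_lintegral_derivWithin_Icc_of_contDiffOn_Icc _ zero_le_one
      rwa [← contMDiffOn_iff_contDiffOn]
    _ = ∫⁻ t' in Icc 0 1, ‖mfderiv[Icc 0 1] γ' t' 1‖ₑ := by
      simp_rw [← fderivWithin_derivWithin, mfderivWithin_eq_fderivWithin]
      rfl
    _ ≤ ∫⁻ t' in Icc 0 1, C * ‖mfderiv[Icc 0 1] γ t' 1‖ₑ := by
      apply MeasureTheory.setLIntegral_mono' measurableSet_Icc (fun t' ht' ↦ ?_)
      have : mfderiv[Icc 0 1] γ' t' =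
          (mfderiv% (extChartAt 𝓘(ℝ, E) p) (γ t')) ∘L (mfderiv[Icc 0 1] γ t') := by
        apply mfderiv_comp_mfderivWithin
        · exact mdifferentiableAt_extChartAt (hball (hstay t' ht')).2
        · exact (γ_smooth.mdifferentiable one_ne_zero).mdifferentiableOn _ ht'
        · rw [uniqueMDiffWithinAt_iff_uniqueDiffWithinAt]
          exact uniqueDiffOn_Icc zero_lt_one _ ht'
      have : mfderiv[Icc 0 1] γ' t' 1 =
          (mfderiv% (extChartAt 𝓘(ℝ, E) p) (γ t')) (mfderiv[Icc 0 1] γ t' 1) :=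
        congr($this 1)
      rw [this]
      apply (ContinuousLinearMap.le_opENorm _ _).trans
      gcongr
      exact le_of_lt (hball (hstay t' ht')).1
    _ = C * pathELength 𝓘(ℝ, E) γ 0 1 := by
      rw [MeasureTheory.lintegral_const_mul' _ _ ENNReal.coe_ne_top,
          pathELength_eq_lintegral_mfderivWithin_Icc]
    _ ≤ C * ENNReal.ofReal l := by gcongr
    _ = ENNReal.ofReal (C * l) := by
      rw [ENNReal.ofReal_mul C.coe_nonneg, ENNReal.ofReal_coe_nnreal]
  rw [← ofReal_norm, ENNReal.ofReal_le_ofReal_iff (by positivity)] at key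
  simpa [hγ', hγ0, hγ1] using key

/-- The Riemannian norm of a vector field is locally controlled by its norm in a chart. -/
theorem eventually_norm_le_norm_chartField (V : (x : M) → TangentSpace 𝓘(ℝ, E) x) (p : M) :
    ∃ C > 0, ∀ᶠ x in 𝓝 p, ‖V x‖ ≤ C * ‖chartField V p (extChartAt 𝓘(ℝ, E) p x)‖ := by
  obtain ⟨C, C_pos, hC⟩ :=
    eventually_norm_symmL_trivializationAt_lt E (fun x : M => TangentSpace 𝓘(ℝ, E) x) p
  refine ⟨C, C_pos, ?_⟩
  filter_upwards [hC, chart_source_mem_nhds E p] with x hx hsrc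
  have hx' : x ∈ (extChartAt 𝓘(ℝ, E) p).source := by rwa [extChartAt_source]
  rw [chartField_extChartAt V hx']
  have h1 : (trivializationAt E (TangentSpace 𝓘(ℝ, E)) p).symmL ℝ x
      ((trivializationAt E (TangentSpace 𝓘(ℝ, E)) p).continuousLinearMapAt ℝ x (V x)) = V x :=
    (trivializationAt E (TangentSpace 𝓘(ℝ, E)) p).symmL_continuousLinearMapAt (by simpa) _
  rw [TangentBundle.continuousLinearMapAt_trivializationAt_eq_core hsrc] at h1
  calc ‖V x‖ = ‖(trivializationAt E (TangentSpace 𝓘(ℝ, E)) p).symmL ℝ x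
        (tangentCoordChange 𝓘(ℝ, E) x p x (V x))‖ := (congrArg norm h1).symm
    _ ≤ C * ‖tangentCoordChange 𝓘(ℝ, E) x p x (V x)‖ :=
        ((trivializationAt E (TangentSpace 𝓘(ℝ, E)) p).symmL ℝ x).le_of_opNorm_le hx.le _

variable [IsRiemannianManifold 𝓘(ℝ, E) M]

/-- On a small ball, the chart is Lipschitz, the vector field read in the chart is Lipschitz, and
it controls the Riemannian norm of the vector field. -/
theorem exists_ball_chart_control {V : (x : M) → TangentSpace 𝓘(ℝ, E) x} {p : M}
    (hV : ContMDiffAt 𝓘(ℝ, E) (𝓘(ℝ, E)).tangent 1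
      (fun x : M => (⟨x, V x⟩ : TangentBundle 𝓘(ℝ, E) M)) p) :
    ∃ C > (0 : ℝ), ∃ L : ℝ≥0, ∃ r > 0, ∃ s : Set E,
      LipschitzOnWith L (chartField V p) s ∧
      ∀ x ∈ ball p r, x ∈ (extChartAt 𝓘(ℝ, E) p).source ∧ extChartAt 𝓘(ℝ, E) p x ∈ s ∧
        ‖V x‖ ≤ C * ‖chartField V p (extChartAt 𝓘(ℝ, E) p x)‖ ∧
        ∀ y ∈ ball p r,
          ‖extChartAt 𝓘(ℝ, E) p x - extChartAt 𝓘(ℝ, E) p y‖ ≤ C * dist x y := by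
  obtain ⟨C₁, hC₁, r₁, hr₁, h1⟩ := exists_ball_dist_extChartAt_le (E := E) p
  obtain ⟨C₂, hC₂, h2⟩ := eventually_norm_le_norm_chartField V p
  obtain ⟨L, s, hs, hL⟩ := (contDiffAt_chartField hV).exists_lipschitzOnWith
  obtain ⟨r₂, hr₂, h3⟩ := Metric.mem_nhds_iff.1 (Filter.inter_mem h2
    (Filter.inter_mem (extChartAt_source_mem_nhds (I := 𝓘(ℝ, E)) p)
      ((continuousAt_extChartAt (I := 𝓘(ℝ, E)) p).preimage_mem_nhds hs)))
  refine ⟨max C₁ C₂, lt_max_of_lt_left hC₁, L, min r₁ r₂, lt_min hr₁ hr₂, s, hL,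
    fun x hx => ?_⟩
  have hx2 := h3 (ball_subset_ball (min_le_right _ _) hx)
  refine ⟨hx2.2.1, hx2.2.2, hx2.1.trans ?_, fun y hy => ?_⟩
  · gcongr; exact le_max_right _ _
  · refine (h1 x (ball_subset_ball (min_le_left _ _) hx) y
      (ball_subset_ball (min_le_left _ _) hy)).trans ?_
    gcongr; exact le_max_left _ _

theorem exists_forall_norm_le [CompactSpace M] {V : (x : M) → TangentSpace 𝓘(ℝ, E) x}
    (hV : ContMDiff 𝓘(ℝ, E) (𝓘(ℝ, E)).tangent 1
      (fun x : M => (⟨x, V x⟩ : TangentBundle 𝓘(ℝ, E) M))) :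
    ∃ C > (0 : ℝ), ∀ x, ‖V x‖ ≤ C := by
  refine exists_forall_of_eventually_nhds (fun C C' x _ h h' => h'.trans h) fun p => ?_
  obtain ⟨C, hC, L, r, hr, s, hL, H⟩ := exists_ball_chart_control (hV p)
  set w := ‖chartField V p (extChartAt 𝓘(ℝ, E) p p)‖
  refine ⟨C * (w + L * (C * r)) + 1, by positivity, ?_⟩
  filter_upwards [ball_mem_nhds p hr] with x hx
  obtain ⟨-, hxs, hx1, hx2⟩ := H x hx
  have hp := mem_ball_self (x := p) hr
  have h1 : ‖chartField V p (extChartAt 𝓘(ℝ, E) p x)‖ ≤ w + L * (C * r) := by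
    have h2 := hL.norm_sub_le hxs (H p hp).2.1
    have h3 : (L : ℝ) * ‖extChartAt 𝓘(ℝ, E) p x - extChartAt 𝓘(ℝ, E) p p‖ ≤ L * (C * r) := by
      have := (mem_ball.1 hx).le
      have h4 := hx2 p hp
      gcongr
      exact h4.trans (by gcongr)
    have h5 := norm_le_norm_sub_add (chartField V p (extChartAt 𝓘(ℝ, E) p x))
      (chartField V p (extChartAt 𝓘(ℝ, E) p p))
    linarith
  have h6 : C * ‖chartField V p (extChartAt 𝓘(ℝ, E) p x)‖ ≤ C * (w + L * (C * r)) := by gcongr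
  linarith

end Chart

variable [IsRiemannianManifold 𝓘(ℝ, E) M]

/-- Integral curves of a bounded vector field are Lipschitz. -/
theorem dist_le_of_isMIntegralCurve {V : (x : M) → TangentSpace 𝓘(ℝ, E) x}
    (hV : ContMDiff 𝓘(ℝ, E) (𝓘(ℝ, E)).tangent 1
      (fun x : M => (⟨x, V x⟩ : TangentBundle 𝓘(ℝ, E) M)))
    {γ : ℝ → M} (hγ : IsMIntegralCurve (I := 𝓘(ℝ, E)) γ V) {K : ℝ} (hK : ∀ x, ‖V x‖ ≤ K)
    (a b : ℝ) : dist (γ a) (γ b) ≤ K * |a - b| := by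
  wlog hab : a ≤ b generalizing a b
  · rw [dist_comm, abs_sub_comm]
    exact this b a (le_of_not_ge hab)
  have hK0 : 0 ≤ K := (norm_nonneg _).trans (hK (γ a))
  have h1 : edist (γ a) (γ b) ≤ ENNReal.ofReal (K * |a - b|) := by
    rw [IsRiemannianManifold.out (I := 𝓘(ℝ, E)) (γ a) (γ b)]
    refine (riemannianEDist_le_pathELength
      (contMDiff_of_isMIntegralCurve hV hγ).contMDiffOn rfl rfl hab).trans ?_
    rw [pathELength_eq_lintegral_mfderiv_Icc]
    calc ∫⁻ t in Icc a b, ‖mfderiv% γ t 1‖ₑ ≤ ∫⁻ _ in Icc a b, ENNReal.ofReal K := by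
          apply MeasureTheory.lintegral_mono
          intro t
          have : mfderiv% γ t 1 = V (γ t) := by
            rw [(hγ t).mfderiv]
            exact one_smul ℝ (V (γ t))
          dsimp only
          rw [this, ← ofReal_norm]
          exact ENNReal.ofReal_le_ofReal (hK _)
      _ = ENNReal.ofReal (K * |a - b|) := by
          rw [MeasureTheory.setLIntegral_const, Real.volume_Icc, ← ENNReal.ofReal_mul hK0,
            abs_sub_comm, abs_of_nonneg (sub_nonneg.2 hab)]
  rwa [edist_dist, ENNReal.ofReal_le_ofReal_iff (by positivity)] at h1

variable [IsContinuousRiemannianBundle E (fun x : M => TangentSpace 𝓘(ℝ, E) x)]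
  [CompactSpace M]

/-- For small times, integral curves move away from their starting point at a rate comparable to
the initial speed. -/
theorem exists_abs_mul_norm_le_dist {V : (x : M) → TangentSpace 𝓘(ℝ, E) x}
    (hV : ContMDiff 𝓘(ℝ, E) (𝓘(ℝ, E)).tangent 1
      (fun x : M => (⟨x, V x⟩ : TangentBundle 𝓘(ℝ, E) M))) :
    ∃ C > (0 : ℝ), ∀ x : M, ∀ γ : ℝ → M, γ 0 = x → IsMIntegralCurve (I := 𝓘(ℝ, E)) γ V →
      ∀ u : ℝ, |u| ≤ C⁻¹ → |u| * ‖V x‖ ≤ C * dist x (γ u) := by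
  refine exists_forall_of_eventually_nhds (fun C C' x hC hCC' h γ h0 hγ u hu => ?_) fun p => ?_
  · refine (h γ h0 hγ u (hu.trans (inv_anti₀ hC hCC'))).trans ?_
    gcongr
  obtain ⟨C, hC, L, r, hr, s, hL, H⟩ := exists_ball_chart_control (hV p)
  obtain ⟨K, hK, hVK⟩ := exists_forall_norm_le hV
  -- `2 * C * C` is the final constant, `4 * L` gives `L * C'⁻¹ ≤ 1/4`, and `2 * K / r` keeps the
  -- curve in the ball.
  set C' : ℝ := 2 * C * C + 4 * L + 2 * K / r + 1 with hC'
  have hKr : 0 < 2 * K / r := by positivity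
  have hC'0 : 0 < C' := by positivity
  refine ⟨C', hC'0, ?_⟩
  filter_upwards [ball_mem_nhds p (half_pos hr)] with x hx γ h0 hγ u hu
  have hmem : ∀ t ∈ Icc (-C'⁻¹) C'⁻¹, γ t ∈ ball p r := by
    intro t ht
    have h1 := dist_le_of_isMIntegralCurve hV hγ hVK t 0
    rw [h0, sub_zero] at h1
    have h2 : K * |t| ≤ K * C'⁻¹ := by gcongr; exact abs_le.2 ht
    have h3 : K * C'⁻¹ ≤ r / 2 := by
      rw [← div_eq_mul_inv, div_le_iff₀ hC'0]
      have h4 : 2 * K / r ≤ C' := by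
        have : 0 ≤ 2 * C * C + 4 * L := by positivity
        linarith
      rw [div_le_iff₀ hr] at h4
      linarith
    have h5 := dist_triangle (γ t) x p
    rw [mem_ball] at hx ⊢
    linarith
  have hux : u ∈ Icc (-C'⁻¹) C'⁻¹ := abs_le.1 hu
  have h00 : (0 : ℝ) ∈ Icc (-C'⁻¹) C'⁻¹ := by
    have : 0 < C'⁻¹ := by positivity
    exact ⟨by linarith, this.le⟩
  have hLT : L * C'⁻¹ ≤ 1 / 4 := by
    rw [← div_eq_mul_inv, div_le_iff₀ hC'0]
    have : 0 ≤ 2 * C * C := by positivity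
    linarith
  have key := abs_mul_norm_le_norm_sub_of_lipschitz hL (f := extChartAt 𝓘(ℝ, E) p ∘ γ)
    (fun t ht => hasDerivAt_extChartAt_comp (hγ t) (H _ (hmem t ht)).1)
    (fun t ht => (H _ (hmem t ht)).2.1) hLT hux
  have hxr : x ∈ ball p r := by simpa [h0] using hmem 0 h00
  simp only [Function.comp_apply, h0] at key
  obtain ⟨-, -, h1, h2⟩ := H x hxr
  have h3 := h2 _ (hmem u hux)
  rw [norm_sub_rev] at h3
  calc |u| * ‖V x‖ ≤ |u| * (C * ‖chartField V p (extChartAt 𝓘(ℝ, E) p x)‖) := by gcongr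
    _ = C * (|u| * ‖chartField V p (extChartAt 𝓘(ℝ, E) p x)‖) := by ring
    _ ≤ C * (2 * (C * dist x (γ u))) := by
        refine mul_le_mul_of_nonneg_left (key.trans ?_) hC.le
        gcongr
    _ = 2 * C * C * dist x (γ u) := by ring
    _ ≤ C' * dist x (γ u) := by
        gcongr
        have : 0 ≤ 4 * (L : ℝ) := by positivity
        linarith

/-- The norm of a `C^1` vector field is at most a constant times the distance to its zeros. -/
theorem exists_norm_le_mul_dist {V : (x : M) → TangentSpace 𝓘(ℝ, E) x}
    (hV : ContMDiff 𝓘(ℝ, E) (𝓘(ℝ, E)).tangent 1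
      (fun x : M => (⟨x, V x⟩ : TangentBundle 𝓘(ℝ, E) M))) :
    ∃ C > (0 : ℝ), ∀ x : M, ∀ a ∈ singSet V, ‖V x‖ ≤ C * dist x a := by
  refine exists_forall_of_eventually_nhds (fun C C' x hC hCC' h a ha =>
    (h a ha).trans (by gcongr)) fun p => ?_
  obtain ⟨C, hC, L, r, hr, s, hL, H⟩ := exists_ball_chart_control (hV p)
  obtain ⟨K, hK, hVK⟩ := exists_forall_norm_le hV
  -- The first term serves zeros in the ball, by the Lipschitz bound; the second serves zeros at
  -- distance at least `r / 2`, by boundedness of `V`.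
  refine ⟨C * (L * C) + 2 * K / r, by positivity, ?_⟩
  filter_upwards [ball_mem_nhds p (half_pos hr)] with x hx a ha
  have hxr : x ∈ ball p r := ball_subset_ball (half_le_self hr.le) hx
  rw [add_mul]
  by_cases har : a ∈ ball p r
  · obtain ⟨-, hxs, h1, h2⟩ := H x hxr
    obtain ⟨hasrc, has, -, -⟩ := H a har
    have h0 : chartField V p (extChartAt 𝓘(ℝ, E) p a) = 0 := by
      rw [chartField_extChartAt V hasrc, show V a = 0 from ha]
      exact map_zero _
    have h3 := hL.norm_sub_le hxs has
    rw [h0, sub_zero] at h3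
    have h4 : C * ‖chartField V p (extChartAt 𝓘(ℝ, E) p x)‖ ≤ C * (L * (C * dist x a)) := by
      gcongr
      exact h3.trans (by gcongr; exact h2 a har)
    have h5 : 0 ≤ 2 * K / r * dist x a := by positivity
    linarith
  · have h1 : r / 2 ≤ dist x a := by
      rw [mem_ball, not_lt] at har
      rw [mem_ball] at hx
      have := dist_triangle_left a p x
      linarith
    have h2 : K ≤ 2 * K / r * dist x a := by
      calc K = 2 * K / r * (r / 2) := by field_simp
        _ ≤ _ := by gcongr
    have h3 : 0 ≤ C * (L * C) * dist x a := by positivity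
    linarith [hVK x]

/-- Without zeros the distance is the diameter by convention; flowing for time `C⁻¹` gives a
displacement that bounds the speed and is at most the diameter. -/
theorem exists_norm_le_mul_distToSet [CompleteSpace E] {V : (x : M) → TangentSpace 𝓘(ℝ, E) x}
    (hV : ContMDiff 𝓘(ℝ, E) (𝓘(ℝ, E)).tangent 1
      (fun x : M => (⟨x, V x⟩ : TangentBundle 𝓘(ℝ, E) M))) :
    ∃ C > (0 : ℝ), ∀ x : M, ‖V x‖ ≤ C * distToSet x (singSet V) := by
  rcases (singSet V).eq_empty_or_nonempty with hS | hS
  · obtain ⟨C, hC, H⟩ := exists_abs_mul_norm_le_dist hV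
    refine ⟨C * C, by positivity, fun x => ?_⟩
    obtain ⟨γ, h0, hγ⟩ := exists_isMIntegralCurve_of_compactSpace hV x
    have hC' : |C⁻¹| = C⁻¹ := abs_of_pos (by positivity)
    have h1 := H x γ h0 hγ C⁻¹ hC'.le
    rw [hC', inv_mul_le_iff₀ hC] at h1
    have h2 : dist x (γ C⁻¹) ≤ diam (univ : Set M) :=
      dist_le_diam_of_mem isCompact_univ.isBounded (mem_univ _) (mem_univ _)
    rw [distToSet, if_pos hS]
    calc ‖V x‖ ≤ C * (C * dist x (γ C⁻¹)) := h1
      _ ≤ C * (C * diam (univ : Set M)) := by gcongr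
      _ = _ := by ring
  · obtain ⟨C, hC, H⟩ := exists_norm_le_mul_dist hV
    refine ⟨C, hC, fun x => ?_⟩
    have := hS.to_subtype
    rw [distToSet, if_neg hS.ne_empty, ← div_le_iff₀' hC]
    refine le_ciInf fun a => ?_
    rw [div_le_iff₀' hC]
    exact H x a a.2

end Riemannian

end RiemFlow
-- From singular to rescaling expansivity
theorem mainTheorem2
    {E : Type*} [NormedAddCommGroup E] [NormedSpace ℝ E] [FiniteDimensional ℝ E]
    {M : Type*} [MetricSpace M] [CompactSpace M] [ConnectedSpace M]
    [ChartedSpace E M] [IsManifold 𝓘(ℝ, E) ∞ M]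
    [Bundle.RiemannianBundle (fun x : M => TangentSpace 𝓘(ℝ, E) x)]
    [IsContMDiffRiemannianBundle 𝓘(ℝ, E) ∞ E (fun x : M => TangentSpace 𝓘(ℝ, E) x)]
    [IsRiemannianManifold 𝓘(ℝ, E) M]
    (V : (x : M) → TangentSpace 𝓘(ℝ, E) x)
    (hV : ContMDiff 𝓘(ℝ, E) (𝓘(ℝ, E)).tangent 1
      (fun x : M => (⟨x, V x⟩ : TangentBundle 𝓘(ℝ, E) M)))
    (Λ : Set M) (hΛ : IsCompact Λ) (hinv : RiemFlow.IsFlowInvariant V Λ)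
    (hsing : RiemFlow.SingularExpansiveOn V Λ) :
    RiemFlow.RescalingExpansiveOn V Λ := by
  have : CompleteSpace E := FiniteDimensional.complete ℝ E
  have : IsContinuousRiemannianBundle E (fun x : M => TangentSpace 𝓘(ℝ, E) x) := by
    obtain ⟨g, hg, h⟩ := IsContMDiffRiemannianBundle.exists_contMDiff (IB := 𝓘(ℝ, E)) (n := ∞)
      (F := E) (E := fun x : M => TangentSpace 𝓘(ℝ, E) x)
    exact ⟨g, hg.continuous, h⟩
  have hflow := fun x => RiemFlow.flow_spec V x
    (RiemFlow.exists_isMIntegralCurve_of_compactSpace hV x)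
  intro ε hε
  obtain ⟨C, hC, hmove⟩ := RiemFlow.exists_abs_mul_norm_le_dist hV
  obtain ⟨K, hK, hnorm⟩ := RiemFlow.exists_norm_le_mul_distToSet hV
  set ε' := min ε (C⁻¹ / 2) with hε'
  have hCi : 0 < C⁻¹ := by positivity
  have hε'0 : 0 < ε' := lt_min hε (by positivity)
  have hε'C : ε' < C⁻¹ := (min_le_right _ _).trans_lt (half_lt_self hCi)
  obtain ⟨δ, hδ, hexp⟩ := hsing ε' hε'0
  -- `δ / K` turns rescaled closeness into singular closeness; `ε' / C` gives the bound on the time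
  -- lag.
  refine ⟨min (δ / K) (ε' / C), lt_min (by positivity) (by positivity), ?_⟩
  intro x hx y hy s hs hclose
  by_cases hx0 : V x = 0
  · have h := hclose 0
    rw [(hflow x).1, hx0, norm_zero, mul_zero] at h
    exact ⟨0, ⟨by linarith, hε.le⟩, (hflow x).1.trans (dist_le_zero.1 h)⟩
  -- By uniqueness, an orbit meeting a zero is constant.
  have hreg : ∀ t, V (RiemFlow.flow V t x) ≠ 0 := by
    intro t ht
    have := isMIntegralCurve_Ioo_eq_of_contMDiff_boundaryless (t₀ := t) hV (hflow x).2
      (isMIntegralCurve_const ht) rfl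
    have h0 := congrFun this 0
    simp only [(hflow x).1] at h0
    exact hx0 (by rw [h0]; exact ht)
  obtain ⟨t₀, r, hr, hrt⟩ := hexp x hx y hy s hs fun t => by
    calc dist (RiemFlow.flow V t x) (RiemFlow.flow V (s t) y)
        ≤ min (δ / K) (ε' / C) * ‖V (RiemFlow.flow V t x)‖ := hclose t
      _ ≤ δ / K * (K * RiemFlow.distToSet (RiemFlow.flow V t x) (RiemFlow.singSet V)) := by
          gcongr
          · exact min_le_left _ _
          · exact hnorm _
      _ = _ := by field_simp
  have horbit : ∀ t, RiemFlow.flow V t y = RiemFlow.flow V (t + (r - s t₀)) x := by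
    refine congrFun (isMIntegralCurve_Ioo_eq_of_contMDiff_boundaryless (t₀ := s t₀) hV (hflow y).2
      ((hflow x).2.comp_add (r - s t₀)) ?_)
    simp only [add_sub_cancel]
    exact hrt.symm
  set h : ℝ → ℝ := fun t => s t + (r - s t₀) - t with hh
  have hcont : Continuous h := by fun_prop
  have hgap : ∀ t, |h t| < C⁻¹ → |h t| ≤ ε' := by
    intro t ht
    have h1 := hmove (RiemFlow.flow V t x) _ (by simp)
      ((hflow x).2.comp_add t) (h t) ht.le
    have h2 := hclose t
    rw [horbit] at h2
    have e : h t + t = s t + (r - s t₀) := by simp [hh]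
    simp only [Function.comp_apply, e] at h1
    have hpos : 0 < ‖V (RiemFlow.flow V t x)‖ := norm_pos_iff.2 (hreg t)
    refine le_of_mul_le_mul_right (h1.trans ?_) hpos
    calc C * _ ≤ C * (min (δ / K) (ε' / C) * ‖V (RiemFlow.flow V t x)‖) := by gcongr
      _ ≤ C * (ε' / C * ‖V (RiemFlow.flow V t x)‖) := by gcongr; exact min_le_right _ _
      _ = _ := by field_simp
  have hclopen : IsClopen {t | |h t| ≤ ε'} := by
    refine ⟨isClosed_le hcont.abs continuous_const, ?_⟩
    -- The gap between `ε'` and `C⁻¹` makes the closed condition equivalent to an open one.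
    have : {t | |h t| ≤ ε'} = {t | |h t| < C⁻¹} :=
      Set.ext fun t => ⟨fun ht => lt_of_le_of_lt ht hε'C, hgap t⟩
    rw [this]
    exact isOpen_lt hcont.abs continuous_const
  have huniv := hclopen.eq_univ ⟨t₀, by
    simp only [hh, mem_ofPred_eq, abs_le]
    exact ⟨by linarith [hr.1], by linarith [hr.2]⟩⟩
  have h0 : |h 0| ≤ ε' := huniv.ge (mem_univ 0)
  refine ⟨h 0, abs_le.1 (h0.trans (min_le_left _ _)), ?_⟩
  rw [horbit]
  simp [hh]
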